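/- Let $\mathcal H$ be a separable (real or complex) Hilbert space and $I$ a countable index set. Let $\{W_i\}_{i\in I}$, $\{V_i\}_{i\in I}$ be families of closed subspaces of $\mathcal H$, let $\omega_i>0$ $(i\in I)$ be weights, and let $\pi_U$ denote the orthogonal projection onto a closed subspace $U$. The family $\{(W_i,\omega_i)\}_{i\in I}$ is a \emph{fusion frame} with bounds $0<C\le D<\infty$ if $$C\|f\|^2\le\sum_{i\in I}\omega_i^2\|\pi_{W_i}f\|^2\le D\|f\|^2\qquad(f\in\mathcal H),$$ and a \emph{Bessel fusion sequence} if the upper estimate holds for some $D$. The fusion frame operator $S_Wf=\sum_{i\in I}\omega_i^2\pi_{W_i}f$ of a fusion frame is bounded and invertible. The family $\{W_i\}_{i\in I}$ is a \emph{fusion Riesz basis} if its closed linear span is $\mathcal H$ and there are constants $C,D>0$ such that $$C\sum_{i\in J}\|f_i\|^2\le\Big\|\sum_{i\in J}f_i\Big\|^2\le D\sum_{i\in J}\|f_i\|^2$$ for every finite $J\subset I$ and all $f_i\in W_i$ $(i\in J)$. \textbf{Theorem.} Let $W=\{(W_i,\omega_i)\}_{i\in I}$ be a fusion frame for $\mathcal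 H$ whose subspaces $\{W_i\}_{i\in I}$ form a fusion Riesz basis, and let $V=\{(V_i,\omega_i)\}_{i\in I}$ be any dual fusion frame of $W$, that is, a Bessel fusion sequence such that $$f=\sum_{i\in I}\omega_i^2\,\pi_{V_i}S_W^{-1}\pi_{W_i}f\qquad(f\in\mathcal H).$$ Then $W$ and $V$ are woven: both are fusion frames for $\mathcal H$, and there are constants $0<C\le D<\infty$ such that for every subset $\sigma\subset I$ the family $\{(W_i,\omega_i)\}_{i\in\sigma}\cup\{(V_i,\omega_i)\}_{i\in I\setminus\sigma}$ is a fusion frame for $\mathcal H$ with bounds $C$ and $D$. -/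

import Mathlib

open scoped InnerProductSpace

section FusionFrames

variable {𝕜 H I : Type*} [RCLike 𝕜] [NormedAddCommGroup H] [InnerProductSpace 𝕜 H]
  [CompleteSpace H]

/-- The orthogonal projection `π_V : H → H` onto a closed subspace `V`. -/
noncomputable def fusionProj (V : ClosedSubmodule 𝕜 H) : H →L[𝕜] H :=
  V.toSubmodule.starProjection

/-- `{(W i, ω i)}` is a fusion frame with bounds `C`, `D`: the weights are positive and
`C ‖f‖² ≤ ∑ i, ω i² ‖π_{W i} f‖² ≤ D ‖f‖²` for all `f`; the upper estimate includes the
convergence of the series of nonnegative terms. -/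
def HasFusionFrameBounds (W : I → ClosedSubmodule 𝕜 H) (ω : I → ℝ) (C D : ℝ) : Prop :=
  (∀ i, 0 < ω i) ∧ ∀ f : H,
    Summable (fun i => ω i ^ 2 * ‖fusionProj (W i) f‖ ^ 2) ∧
    C * ‖f‖ ^ 2 ≤ ∑' i, ω i ^ 2 * ‖fusionProj (W i) f‖ ^ 2 ∧
    ∑' i, ω i ^ 2 * ‖fusionProj (W i) f‖ ^ 2 ≤ D * ‖f‖ ^ 2

/-- Fusion frames for `H`. -/
def IsFusionFrame (W : I → ClosedSubmodule 𝕜 H) (ω : I → ℝ) : Prop :=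
  ∃ C D : ℝ, 0 < C ∧ C ≤ D ∧ HasFusionFrameBounds W ω C D

/-- Bessel fusion sequences: only the upper estimate is required. -/
def IsBesselFusionSequence (W : I → ClosedSubmodule 𝕜 H) (ω : I → ℝ) : Prop :=
  (∀ i, 0 < ω i) ∧ ∃ D : ℝ, 0 < D ∧ ∀ f : H,
    Summable (fun i => ω i ^ 2 * ‖fusionProj (W i) f‖ ^ 2) ∧
    ∑' i, ω i ^ 2 * ‖fusionProj (W i) f‖ ^ 2 ≤ D * ‖f‖ ^ 2

/-- Fusion Riesz sequences of closed subspaces. -/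
def IsFusionRieszSequence (W : I → ClosedSubmodule 𝕜 H) : Prop :=
  ∃ C D : ℝ, 0 < C ∧ 0 < D ∧ ∀ (J : Finset I) (f : I → H), (∀ i ∈ J, f i ∈ W i) →
    C * ∑ i ∈ J, ‖f i‖ ^ 2 ≤ ‖∑ i ∈ J, f i‖ ^ 2 ∧
    ‖∑ i ∈ J, f i‖ ^ 2 ≤ D * ∑ i ∈ J, ‖f i‖ ^ 2

/-- Fusion Riesz bases: fusion Riesz sequences that are complete, that is, whose closed linear
span is all of `H`. -/
def IsFusionRieszBasis (W : I → ClosedSubmodule 𝕜 H) : Prop :=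
  IsFusionRieszSequence W ∧ (⨆ i, (W i).toSubmodule).topologicalClosure = ⊤

theorem IsFusionFrame.isBesselFusionSequence {W : I → ClosedSubmodule 𝕜 H} {ω : I → ℝ}
    (hW : IsFusionFrame W ω) : IsBesselFusionSequence W ω := by
  obtain ⟨C, D, hC, hCD, hω, h⟩ := hW
  exact ⟨hω, D, hC.trans_le hCD, fun f => ⟨(h f).1, (h f).2.2⟩⟩

theorem inner_fusionProj_eq (V : ClosedSubmodule 𝕜 H) (f g : H) :
    ⟪fusionProj V f, g⟫_𝕜 = ⟪fusionProj V f, fusionProj V g⟫_𝕜 := by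
  unfold fusionProj
  rw [← sub_eq_zero, ← inner_sub_right]
  exact Submodule.inner_right_of_mem_orthogonal (Submodule.starProjection_apply_mem _ f)
    (Submodule.sub_starProjection_mem_orthogonal g)

theorem norm_sq_sum_fusionProj_le {W : I → ClosedSubmodule 𝕜 H} {ω : I → ℝ} {D : ℝ}
    (h : ∀ f : H, Summable (fun i => ω i ^ 2 * ‖fusionProj (W i) f‖ ^ 2) ∧
      ∑' i, ω i ^ 2 * ‖fusionProj (W i) f‖ ^ 2 ≤ D * ‖f‖ ^ 2) (f : H) (J : Finset I) :
    ‖∑ i ∈ J, ((ω i ^ 2 : ℝ) : 𝕜) • fusionProj (W i) f‖ ^ 2 ≤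
      D * ∑ i ∈ J, ω i ^ 2 * ‖fusionProj (W i) f‖ ^ 2 := by
  set g := ∑ i ∈ J, ((ω i ^ 2 : ℝ) : 𝕜) • fusionProj (W i) f with hg
  set A := ∑ i ∈ J, ω i ^ 2 * ‖fusionProj (W i) f‖ ^ 2 with hA
  have hA0 : 0 ≤ A := Finset.sum_nonneg fun i _ => by positivity
  have h1 : ‖g‖ ^ 2 ≤ ∑ i ∈ J, (|ω i| * ‖fusionProj (W i) f‖) * (|ω i| * ‖fusionProj (W i) g‖) := by
    have h0 : ‖g‖ ^ 2 = ‖⟪g, g⟫_𝕜‖ := by rw [inner_self_eq_norm_sq_to_K]; simp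
    rw [h0]
    calc ‖⟪g, g⟫_𝕜‖ = ‖∑ i ∈ J, ⟪((ω i ^ 2 : ℝ) : 𝕜) • fusionProj (W i) f, g⟫_𝕜‖ := by
          rw [← sum_inner, ← hg]
      _ ≤ ∑ i ∈ J, ‖⟪((ω i ^ 2 : ℝ) : 𝕜) • fusionProj (W i) f, g⟫_𝕜‖ := norm_sum_le _ _
      _ ≤ _ := Finset.sum_le_sum fun i _ => by
          rw [inner_smul_left, norm_mul, inner_fusionProj_eq, RCLike.norm_conj, RCLike.norm_ofReal,
            abs_of_nonneg (sq_nonneg _), ← sq_abs]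
          nlinarith [norm_inner_le_norm (𝕜 := 𝕜) (fusionProj (W i) f) (fusionProj (W i) g),
            sq_nonneg |ω i|]
  have h2 := Finset.sum_mul_sq_le_sq_mul_sq J (fun i => |ω i| * ‖fusionProj (W i) f‖)
    (fun i => |ω i| * ‖fusionProj (W i) g‖)
  simp only [mul_pow, sq_abs] at h2
  have h3 : ∑ i ∈ J, ω i ^ 2 * ‖fusionProj (W i) g‖ ^ 2 ≤ D * ‖g‖ ^ 2 :=
    ((h g).1.sum_le_tsum J fun i _ => by positivity).trans (h g).2
  have h4 : (‖g‖ ^ 2) ^ 2 ≤ A * (D * ‖g‖ ^ 2) :=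
    (pow_le_pow_left₀ (by positivity) h1 2).trans (h2.trans (mul_le_mul_of_nonneg_left h3 hA0))
  rcases eq_or_lt_of_le (sq_nonneg ‖g‖) with h0 | h0
  · rw [← h0]
    have hD : 0 ≤ D * ‖f‖ ^ 2 :=
      (tsum_nonneg fun i => by positivity).trans (h f).2
    by_cases hf : f = 0
    · simp [hA, hf]
    · exact mul_nonneg (nonneg_of_mul_nonneg_left hD (by positivity)) hA0
  · nlinarith

theorem summable_fusionFrameOperator {W : I → ClosedSubmodule 𝕜 H} {ω : I → ℝ}
    (hW : IsBesselFusionSequence W ω) (f : H) :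
    Summable (fun i => ((ω i ^ 2 : ℝ) : 𝕜) • fusionProj (W i) f) := by
  obtain ⟨-, D, hD, h⟩ := hW
  rw [summable_iff_vanishing_norm]
  intro ε hε
  obtain ⟨s, hs⟩ := summable_iff_vanishing_norm.1 (h f).1 (ε ^ 2 / D) (by positivity)
  refine ⟨s, fun t ht => ?_⟩
  have h1 := norm_sq_sum_fusionProj_le h f t
  have h2 := (le_abs_self _).trans_lt (hs t ht)
  rw [lt_div_iff₀ hD] at h2
  exact lt_of_pow_lt_pow_left₀ 2 hε.le (by linarith)

/-- The fusion frame operator `S_W f = ∑ i, ω i² π_{W i} f` of a Bessel fusion sequence, as a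
bounded operator. -/
noncomputable def fusionFrameOperator {W : I → ClosedSubmodule 𝕜 H} {ω : I → ℝ}
    (hW : IsBesselFusionSequence W ω) : H →L[𝕜] H :=
  LinearMap.mkContinuousOfExistsBound
    { toFun := fun f => ∑' i, ((ω i ^ 2 : ℝ) : 𝕜) • fusionProj (W i) f
      map_add' := fun f g => by
        simp only [map_add, smul_add]
        exact (summable_fusionFrameOperator hW f).tsum_add (summable_fusionFrameOperator hW g)
      map_smul' := fun c f => by
        simp only [map_smul, RingHom.id_apply]
        rw [← (summable_fusionFrameOperator hW f).tsum_const_smul c]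
        exact tsum_congr fun i => smul_comm _ _ _ }
    (by
      obtain ⟨D, hD, h⟩ := hW.2
      refine ⟨D, fun f => ?_⟩
      refine le_of_tendsto (summable_fusionFrameOperator hW f).hasSum.norm
        (Filter.Eventually.of_forall fun J => ?_)
      refine le_of_sq_le_sq ?_ (by positivity)
      have h1 := norm_sq_sum_fusionProj_le h f J
      have h2 := ((h f).1.sum_le_tsum J fun i _ => by positivity).trans (h f).2
      have h3 := mul_le_mul_of_nonneg_left h2 hD.le
      calc _ ≤ _ := h1.trans h3
        _ = _ := by ring)

theorem hasSum_fusionFrameOperator {W : I → ClosedSubmodule 𝕜 H} {ω : I → ℝ}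
    (hW : IsBesselFusionSequence W ω) (f : H) :
    HasSum (fun i => ((ω i ^ 2 : ℝ) : 𝕜) • fusionProj (W i) f) (fusionFrameOperator hW f) :=
  (summable_fusionFrameOperator hW f).hasSum

/-- The fusion frame operator of a fusion frame is invertible. -/
theorem isUnit_fusionFrameOperator {W : I → ClosedSubmodule 𝕜 H} {ω : I → ℝ}
    (hW : IsFusionFrame W ω) : IsUnit (fusionFrameOperator hW.isBesselFusionSequence) := by
  have hB := hW.isBesselFusionSequence
  obtain ⟨C, D, hC, hCD, hω, h⟩ := hW
  refine ContinuousLinearMap.isUnit_of_forall_le_norm_inner_map _ (c := ⟨C, hC.le⟩) hC fun f => ?_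
  have h1 := (hasSum_fusionFrameOperator hB f).mapL (innerSL 𝕜 f)
  have h2 := h1.mapL RCLike.reCLM
  have h3 : ∀ i, RCLike.reCLM (innerSL 𝕜 f (((ω i ^ 2 : ℝ) : 𝕜) • fusionProj (W i) f)) =
      ω i ^ 2 * ‖fusionProj (W i) f‖ ^ 2 := by
    intro i
    rw [innerSL_apply_apply, inner_smul_right, RCLike.reCLM_apply, RCLike.re_ofReal_mul,
      inner_re_symm, inner_fusionProj_eq, inner_self_eq_norm_sq]
  simp only [h3] at h2
  have h4 := (h f).2.1
  rw [h2.tsum_eq, RCLike.reCLM_apply, innerSL_apply_apply] at h4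
  rw [norm_inner_symm, mul_comm]
  exact h4.trans (RCLike.re_le_norm _)

/-- The inverse `S_W⁻¹` of the fusion frame operator of a fusion frame. -/
noncomputable def fusionFrameOperatorInv {W : I → ClosedSubmodule 𝕜 H} {ω : I → ℝ}
    (hW : IsFusionFrame W ω) : H →L[𝕜] H :=
  ((isUnit_fusionFrameOperator hW).unit⁻¹ : (H →L[𝕜] H)ˣ)

theorem fusionFrameOperatorInv_apply_apply {W : I → ClosedSubmodule 𝕜 H} {ω : I → ℝ}
    (hW : IsFusionFrame W ω) (f : H) :
    fusionFrameOperatorInv hW (fusionFrameOperator hW.isBesselFusionSequence f) = f :=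
  congrArg (fun T : H →L[𝕜] H => T f) (isUnit_fusionFrameOperator hW).val_inv_mul

theorem fusionFrameOperator_apply_inv_apply {W : I → ClosedSubmodule 𝕜 H} {ω : I → ℝ}
    (hW : IsFusionFrame W ω) (f : H) :
    fusionFrameOperator hW.isBesselFusionSequence (fusionFrameOperatorInv hW f) = f :=
  congrArg (fun T : H →L[𝕜] H => T f) (isUnit_fusionFrameOperator hW).mul_val_inv

/-- `{(V i, ν i)}` is a dual fusion frame of the fusion frame `{(W i, ω i)}`: it is a Bessel fusion
sequence and `f = ∑ i, ω i ν i π_{V i} S_W⁻¹ π_{W i} f` for all `f`. -/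
def IsDualFusionFrame {W : I → ClosedSubmodule 𝕜 H} {ω : I → ℝ} (hW : IsFusionFrame W ω)
    (V : I → ClosedSubmodule 𝕜 H) (ν : I → ℝ) : Prop :=
  IsBesselFusionSequence V ν ∧ ∀ f : H,
    HasSum (fun i => ((ω i * ν i : ℝ) : 𝕜) •
      fusionProj (V i) (fusionFrameOperatorInv hW (fusionProj (W i) f))) f

/-- A finite collection `{(W j i, ω j i)}`, `j < M`, of fusion frames is woven. A partition
`σ_0, …, σ_{M-1}` of `I` into (possibly empty) parts is given by the map `p : I → Fin M` sending
`i` to the index of the part that contains it; the weaving is then `{(W (p i) i, ω (p i) i)}`. -/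
def IsWovenFusion {M : ℕ} (W : Fin M → I → ClosedSubmodule 𝕜 H) (ω : Fin M → I → ℝ) : Prop :=
  (∀ j, IsFusionFrame (W j) (ω j)) ∧
  ∃ C D : ℝ, 0 < C ∧ C ≤ D ∧ ∀ p : I → Fin M,
    HasFusionFrameBounds (fun i => W (p i) i) (fun i => ω (p i) i) C D

end FusionFrames

/-! Write `S` for the frame operator of `W`. Uniqueness of expansions in a fusion Riesz sequence
forces, for `g ∈ W j`, the expansion `g = ∑ ω i² π_{W i} S⁻¹ g` to reduce to its `j`-th term. The
duality formula at `S⁻¹ g` then collapses to `S⁻¹ g = π_{V j} S⁻¹ g`, so `S⁻¹ (W j) ⊆ V j`.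

Given `σ`, split `f = a + b` with `a` in the closed span of `W i`, `i ∈ σ`, and `b` orthogonal to
it. Then `a = S S⁻¹ a` expands in the `W i` with `i ∈ σ` only, and `b = S⁻¹ S b` in the `S⁻¹ (W i) ⊆
V i` with `i ∉ σ` only. Together they expand `f` along the weaving, with coefficients bounded
independently of `σ`; Cauchy–Schwarz (`norm_sq_le_of_hasSum`) turns this into the uniform lower
bound. The upper bound is the sum of the two Bessel bounds. -/

section Weaving

variable {𝕜 H I : Type*} [RCLike 𝕜] [NormedAddCommGroup H] [InnerProductSpace 𝕜 H]

/-- Expansions with respect to a fusion Riesz sequence are unique. -/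
theorem IsFusionRieszSequence.eq_zero_of_hasSum_zero {W : I → ClosedSubmodule 𝕜 H}
    (hW : IsFusionRieszSequence W) {h : I → H} (hmem : ∀ i, h i ∈ W i) (hsum : HasSum h 0)
    (i : I) : h i = 0 := by
  classical
  obtain ⟨C, D, hC, -, hCD⟩ := hW
  have hlim : Filter.Tendsto (fun J : Finset I => ‖∑ i ∈ J, h i‖ ^ 2) Filter.atTop (nhds 0) := by
    simpa using (Filter.Tendsto.norm hsum).pow 2
  -- The lower Riesz bound controls each single term by partial sums that tend to zero.
  have hle : C * ‖h i‖ ^ 2 ≤ 0 := by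
    refine ge_of_tendsto hlim ((Filter.eventually_ge_atTop {i}).mono fun J hJ => ?_)
    have h1 : ‖h i‖ ^ 2 ≤ ∑ i ∈ J, ‖h i‖ ^ 2 :=
      Finset.single_le_sum (f := fun i => ‖h i‖ ^ 2) (fun _ _ => sq_nonneg _)
        (hJ (Finset.mem_singleton_self i))
    exact (mul_le_mul_of_nonneg_left h1 hC.le).trans (hCD J h fun i _ => hmem i).1
  have h2 : ‖h i‖ ^ 2 = 0 :=
    le_antisymm (nonpos_of_mul_nonpos_right hle hC) (sq_nonneg _)
  simpa using h2

variable [CompleteSpace H]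

theorem fusionProj_mem (V : ClosedSubmodule 𝕜 H) (f : H) : fusionProj V f ∈ V :=
  Submodule.starProjection_apply_mem V.toSubmodule f

theorem fusionProj_eq_self {V : ClosedSubmodule 𝕜 H} {f : H} (hf : f ∈ V) :
    fusionProj V f = f :=
  Submodule.starProjection_eq_self_iff.2 hf

theorem inner_fusionProj_right {V : ClosedSubmodule 𝕜 H} {x : H} (hx : x ∈ V) (f : H) :
    ⟪x, fusionProj V f⟫_𝕜 = ⟪x, f⟫_𝕜 := by
  have h := inner_fusionProj_eq V x f
  rw [fusionProj_eq_self hx] at h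
  exact h.symm

theorem fusionProj_eq_zero {V : ClosedSubmodule 𝕜 H} {f : H}
    (hf : ∀ x ∈ V, ⟪x, f⟫_𝕜 = 0) : fusionProj V f = 0 := by
  have h := inner_fusionProj_eq V f f
  rw [hf _ (fusionProj_mem V f)] at h
  exact inner_self_eq_zero.1 h.symm

/-- For a fusion frame of Riesz type, the coefficients of an element of `W j` with respect to
the frame expansion `g = ∑ i, ω i² π_{W i} S_W⁻¹ g` are concentrated in `j`. -/
theorem fusionProj_fusionFrameOperatorInv_of_mem [DecidableEq I] {W : I → ClosedSubmodule 𝕜 H}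
    {ω : I → ℝ} (hW : IsFusionFrame W ω) (hR : IsFusionRieszSequence W) {j : I} {g : H}
    (hg : g ∈ W j) (i : I) :
    ((ω i ^ 2 : ℝ) : 𝕜) • fusionProj (W i) (fusionFrameOperatorInv hW g) =
      if i = j then g else 0 := by
  have h1 := hasSum_fusionFrameOperator hW.isBesselFusionSequence (fusionFrameOperatorInv hW g)
  rw [fusionFrameOperator_apply_inv_apply] at h1
  -- The one-term family `g` at `j` also expands `g` along `W`; the difference of the two expansions
  -- sums to zero.
  have h2 := h1.sub (hasSum_ite_eq j g)
  rw [sub_self] at h2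
  refine sub_eq_zero.1 (hR.eq_zero_of_hasSum_zero (fun i => ?_) h2 i)
  refine (W i).toSubmodule.sub_mem ((W i).toSubmodule.smul_mem _ (fusionProj_mem _ _)) ?_
  split_ifs with h
  · exact h ▸ hg
  · exact (W i).toSubmodule.zero_mem

/-- Positive weights cancel from the off-diagonal coefficients. This is what confines the expansion
of `a` to `σ`. -/
theorem fusionProj_fusionFrameOperatorInv_eq_zero {W : I → ClosedSubmodule 𝕜 H}
    {ω : I → ℝ} (hW : IsFusionFrame W ω) (hR : IsFusionRieszSequence W) {i j : I} (hij : i ≠ j)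
    {g : H} (hg : g ∈ W j) : fusionProj (W i) (fusionFrameOperatorInv hW g) = 0 := by
  classical
  have h := fusionProj_fusionFrameOperatorInv_of_mem hW hR hg i
  have hω : ω i ≠ 0 := (hW.isBesselFusionSequence.1 i).ne'
  rw [if_neg hij, smul_eq_zero] at h
  exact h.resolve_left (by simpa using hω)

/-- Every dual fusion frame of a fusion Riesz basis contains the canonical dual. -/
theorem IsDualFusionFrame.fusionFrameOperatorInv_mem {W V : I → ClosedSubmodule 𝕜 H}
    {ω : I → ℝ} {hW : IsFusionFrame W ω} (hV : IsDualFusionFrame hW V ω)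
    (hR : IsFusionRieszSequence W) {j : I} {g : H} (hg : g ∈ W j) :
    fusionFrameOperatorInv hW g ∈ V j := by
  classical
  have h1 := hV.2 (fusionFrameOperatorInv hW g)
  have h2 := hasSum_ite_eq j (fusionProj (V j) (fusionFrameOperatorInv hW g))
  have h3 : fusionFrameOperatorInv hW g = fusionProj (V j) (fusionFrameOperatorInv hW g) := by
    refine h1.unique ?_
    convert h2 using 2 with i
    -- The weight is moved inside next to `π_{W i}`, where the collapsed coefficients apply.
    rw [← map_smul, ← map_smul, ← map_smul, ← pow_two,
      map_smul, fusionProj_fusionFrameOperatorInv_of_mem hW hR hg i]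
    split_ifs with h
    · rw [h]
    · simp
  rw [h3]
  exact fusionProj_mem _ _

/-- If `f = ∑ i, ω i² x i` with `x i ∈ X i` and `∑ i, ω i² ‖x i‖² ≤ B ‖f‖²`, then
`‖f‖² ≤ B ∑ i, ω i² ‖π_{X i} f‖²`. -/
theorem norm_sq_le_of_hasSum {X : I → ClosedSubmodule 𝕜 H} {ω : I → ℝ} {f : H} {x : I → H}
    {B : ℝ} (hB : 0 < B) (hmem : ∀ i, x i ∈ X i)
    (hf : HasSum (fun i => ((ω i ^ 2 : ℝ) : 𝕜) • x i) f)
    (hx : Summable fun i => ω i ^ 2 * ‖x i‖ ^ 2) (hxB : ∑' i, ω i ^ 2 * ‖x i‖ ^ 2 ≤ B * ‖f‖ ^ 2)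
    (hX : Summable fun i => ω i ^ 2 * ‖fusionProj (X i) f‖ ^ 2) :
    ‖f‖ ^ 2 ≤ B * ∑' i, ω i ^ 2 * ‖fusionProj (X i) f‖ ^ 2 := by
  have h1 := (hf.mapL (innerSL 𝕜 f)).mapL RCLike.reCLM
  have h2 : ∀ i, RCLike.reCLM (innerSL 𝕜 f (((ω i ^ 2 : ℝ) : 𝕜) • x i)) ≤
      (1 / (2 * B)) * (ω i ^ 2 * ‖x i‖ ^ 2) +
        B / 2 * (ω i ^ 2 * ‖fusionProj (X i) f‖ ^ 2) := by
    intro i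
    rw [innerSL_apply_apply, inner_smul_right, RCLike.reCLM_apply, RCLike.re_ofReal_mul,
      inner_re_symm, ← inner_fusionProj_right (hmem i)]
    have h3 : RCLike.re ⟪x i, fusionProj (X i) f⟫_𝕜 ≤ ‖x i‖ * ‖fusionProj (X i) f‖ :=
      re_inner_le_norm _ _
    -- Weighted AM–GM; the weight `1 / (2 * B)` makes the `x i` part total at most `‖f‖² / 2`, which
    -- is absorbed on the left.
    have h4 : ‖x i‖ * ‖fusionProj (X i) f‖ ≤
        1 / (2 * B) * ‖x i‖ ^ 2 + B / 2 * ‖fusionProj (X i) f‖ ^ 2 := by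
      have h5 : 1 / (2 * B) * ‖x i‖ ^ 2 + B / 2 * ‖fusionProj (X i) f‖ ^ 2 -
          ‖x i‖ * ‖fusionProj (X i) f‖ =
          1 / (2 * B) * (‖x i‖ - B * ‖fusionProj (X i) f‖) ^ 2 := by
        field_simp
        ring
      have h6 : 0 ≤ 1 / (2 * B) * (‖x i‖ - B * ‖fusionProj (X i) f‖) ^ 2 := by positivity
      linarith
    calc _ ≤ ω i ^ 2 * (1 / (2 * B) * ‖x i‖ ^ 2 + B / 2 * ‖fusionProj (X i) f‖ ^ 2) :=
          mul_le_mul_of_nonneg_left (h3.trans h4) (sq_nonneg _)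
      _ = _ := by ring
  have h3 := hasSum_le h2 h1 ((hx.hasSum.mul_left _).add (hX.hasSum.mul_left _))
  rw [innerSL_apply_apply, RCLike.reCLM_apply, inner_self_eq_norm_sq] at h3
  have h4 : 1 / (2 * B) * ∑' i, ω i ^ 2 * ‖x i‖ ^ 2 ≤ ‖f‖ ^ 2 / 2 :=
    calc _ ≤ 1 / (2 * B) * (B * ‖f‖ ^ 2) := mul_le_mul_of_nonneg_left hxB (by positivity)
      _ = _ := by field_simp
  linarith

/-- Uniform lower bound for the weavings of a fusion Riesz basis and a dual fusion frame. -/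
theorem IsDualFusionFrame.norm_sq_le_weaving {W V X : I → ClosedSubmodule 𝕜 H}
    {ω : I → ℝ} {hW : IsFusionFrame W ω} (hV : IsDualFusionFrame hW V ω)
    (hR : IsFusionRieszSequence W) {D : ℝ} (hD : 0 < D)
    (hWD : ∀ f : H, Summable (fun i => ω i ^ 2 * ‖fusionProj (W i) f‖ ^ 2) ∧
      ∑' i, ω i ^ 2 * ‖fusionProj (W i) f‖ ^ 2 ≤ D * ‖f‖ ^ 2)
    (σ : Set I) (hσ : ∀ i ∈ σ, X i = W i) (hσc : ∀ i ∉ σ, X i = V i) (f : H)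
    (hX : Summable fun i => ω i ^ 2 * ‖fusionProj (X i) f‖ ^ 2) :
    ‖f‖ ^ 2 ≤ D * (‖fusionFrameOperatorInv hW‖ ^ 2 + 1) *
      ∑' i, ω i ^ 2 * ‖fusionProj (X i) f‖ ^ 2 := by
  classical
  set T := fusionFrameOperatorInv hW
  set M : Submodule 𝕜 H := (⨆ i ∈ σ, (W i).toSubmodule).topologicalClosure 
  have hWM : ∀ i ∈ σ, ∀ x ∈ W i, x ∈ M := fun i hi x hx =>
    Submodule.le_topologicalClosure _
      ((le_iSup₂_of_le (f := fun i (_ : i ∈ σ) => (W i).toSubmodule) i hi le_rfl) hx)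
  have : CompleteSpace M :=
    (Submodule.isClosed_topologicalClosure _).completeSpace_coe
  set a := M.starProjection f
  set b := f - a with hb
  have haM : a ∈ M := Submodule.starProjection_apply_mem M f
  have hbM : b ∈ Mᗮ := Submodule.sub_starProjection_mem_orthogonal f
  have hab : ‖a‖ ^ 2 + ‖b‖ ^ 2 = ‖f‖ ^ 2 := by
    have h := norm_add_sq_eq_norm_sq_add_norm_sq_of_inner_eq_zero a b
      (Submodule.inner_right_of_mem_orthogonal haM hbM)
    rw [hb, add_sub_cancel] at h
    simp only [pow_two]
    exact h.symm
  have hTa : ∀ i ∉ σ, fusionProj (W i) (T a) = 0 := by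
    intro i hi
    -- The kernel of `π_{W i} T` is closed and contains every `W j` with `j ∈ σ`, hence `M`.
    have h := Submodule.topologicalClosure_minimal
      (⨆ i ∈ σ, (W i).toSubmodule) (t := ((fusionProj (W i)) ∘L T).ker)
      (iSup₂_le fun j hj x hx => fusionProj_fusionFrameOperatorInv_eq_zero hW hR
        (ne_of_mem_of_not_mem hj hi).symm hx) (ContinuousLinearMap.isClosed_ker _)
    exact h haM
  have hWb : ∀ i ∈ σ, fusionProj (W i) b = 0 := fun i hi => fusionProj_eq_zero fun x hx =>
    Submodule.inner_right_of_mem_orthogonal (hWM i hi x hx) hbM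
  -- The second summand vanishes on `σ` and the first off `σ`, so no case distinction is needed.
  set x : I → H := fun i => fusionProj (W i) (T a) + T (fusionProj (W i) b) with hx
  have hxX : ∀ i, x i ∈ X i := by
    intro i
    by_cases hi : i ∈ σ
    · simp only [hx, hWb i hi, map_zero, add_zero, hσ i hi]
      exact fusionProj_mem _ _
    · simp only [hx, hTa i hi, zero_add, hσc i hi]
      exact hV.fusionFrameOperatorInv_mem hR (fusionProj_mem _ _)
  have hsum : HasSum (fun i => ((ω i ^ 2 : ℝ) : 𝕜) • x i) f := by
    have h1 := hasSum_fusionFrameOperator hW.isBesselFusionSequence (T a)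
    have h2 := (hasSum_fusionFrameOperator hW.isBesselFusionSequence b).mapL T
    rw [fusionFrameOperator_apply_inv_apply] at h1
    rw [fusionFrameOperatorInv_apply_apply] at h2
    have h3 := h1.add h2
    simp only [map_smul, ← smul_add] at h3
    rwa [hb, add_sub_cancel] at h3
  have hle : ∀ i, ω i ^ 2 * ‖x i‖ ^ 2 ≤ ω i ^ 2 * ‖fusionProj (W i) (T a)‖ ^ 2 +
      ‖T‖ ^ 2 * (ω i ^ 2 * ‖fusionProj (W i) b‖ ^ 2) := by
    intro i
    by_cases hi : i ∈ σ
    · simp [hx, hWb i hi]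
    · have h := pow_le_pow_left₀ (norm_nonneg _) (T.le_opNorm (fusionProj (W i) b)) 2
      have h' := mul_le_mul_of_nonneg_left h (sq_nonneg (ω i))
      simp only [hx, hTa i hi, zero_add, norm_zero]
      linarith
  have hdom := (hWD (T a)).1.add ((hWD b).1.mul_left (‖T‖ ^ 2))
  have hxs : Summable fun i => ω i ^ 2 * ‖x i‖ ^ 2 :=
    hdom.of_nonneg_of_le (fun i => by positivity) hle
  refine norm_sq_le_of_hasSum (by positivity) hxX hsum hxs ?_ hX
  have h1 := hxs.tsum_le_tsum hle hdom
  rw [(hWD (T a)).1.tsum_add ((hWD b).1.mul_left (‖T‖ ^ 2)), tsum_mul_left] at h1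
  have h2 : ‖T a‖ ^ 2 ≤ ‖T‖ ^ 2 * ‖a‖ ^ 2 := by
    rw [← mul_pow]
    exact pow_le_pow_left₀ (norm_nonneg _) (T.le_opNorm a) 2
  have h3 := mul_le_mul_of_nonneg_left h2 hD.le
  have h4 := mul_le_mul_of_nonneg_left (hWD b).2 (sq_nonneg ‖T‖)
  have h5 := (hWD (T a)).2
  -- The estimate holds with `D * ‖T‖ ^ 2`; the extra `+ 1` only keeps the constant positive when `T
  -- = 0`, and this is its slack.
  have h6 : 0 ≤ D * ‖f‖ ^ 2 := by positivity
  rw [← hab] at h6 ⊢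
  linarith

end Weaving

theorem mainTheorem1 {𝕜 H I : Type*} [RCLike 𝕜] [NormedAddCommGroup H] [InnerProductSpace 𝕜 H]
    [CompleteSpace H] [TopologicalSpace.SeparableSpace H] [Countable I]
    (W V : I → ClosedSubmodule 𝕜 H) (ω : I → ℝ)
    (hW : IsFusionFrame W ω) (hR : IsFusionRieszBasis W)
    (hV : IsDualFusionFrame hW V ω) :
    IsWovenFusion ![W, V] ![ω, ω] := by
  obtain ⟨hω, D₁, hD₁, h₁⟩ := hW.isBesselFusionSequence
  obtain ⟨-, D₂, hD₂, h₂⟩ := hV.1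
  set B := D₁ * (‖fusionFrameOperatorInv hW‖ ^ 2 + 1)
  have hB0 : 0 < B := by positivity
  have hweave : ∃ C D : ℝ, 0 < C ∧ C ≤ D ∧ ∀ p : I → Fin 2,
      HasFusionFrameBounds (fun i => (![W, V] : Fin 2 → I → ClosedSubmodule 𝕜 H) (p i) i)
        (fun i => (![ω, ω] : Fin 2 → I → ℝ) (p i) i) C D := by
    -- `D₁ + D₂` is already an upper bound; adding `B⁻¹` makes `C ≤ D` immediate, even for `H = 0`.
    refine ⟨B⁻¹, B⁻¹ + (D₁ + D₂), by positivity, by linarith, fun p => ?_⟩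
    have hωp : (fun i => (![ω, ω] : Fin 2 → I → ℝ) (p i) i) = ω := by
      funext i
      rcases Fin.exists_fin_two.1 ⟨p i, rfl⟩ with h | h <;> simp [h]
    rw [hωp]
    set X : I → ClosedSubmodule 𝕜 H :=
      fun i => (![W, V] : Fin 2 → I → ClosedSubmodule 𝕜 H) (p i) i with hX
    have hXW : ∀ i ∈ {i | p i = 0}, X i = W i := fun i (hi : p i = 0) => by simp [hX, hi]
    have hXV : ∀ i ∉ {i | p i = 0}, X i = V i := fun i (hi : ¬p i = 0) => by
      simp [hX, Fin.eq_one_of_ne_zero _ hi]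
    refine ⟨hω, fun f => ?_⟩
    have hle : ∀ i, ω i ^ 2 * ‖fusionProj (X i) f‖ ^ 2 ≤
        ω i ^ 2 * ‖fusionProj (W i) f‖ ^ 2 + ω i ^ 2 * ‖fusionProj (V i) f‖ ^ 2 := by
      intro i
      by_cases hi : i ∈ {i | p i = 0}
      · rw [hXW i hi]
        exact le_add_of_nonneg_right (by positivity)
      · rw [hXV i hi]
        exact le_add_of_nonneg_left (by positivity)
    have hdom := (h₁ f).1.add (h₂ f).1
    have hs := hdom.of_nonneg_of_le (fun i => by positivity) hle
    refine ⟨hs, ?_, ?_⟩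
    · rw [inv_mul_le_iff₀ hB0]
      exact hV.norm_sq_le_weaving hR.1 hD₁ h₁ _ hXW hXV f hs
    · have h3 := hs.tsum_le_tsum hle hdom
      rw [(h₁ f).1.tsum_add (h₂ f).1] at h3
      have h4 : 0 ≤ B⁻¹ * ‖f‖ ^ 2 := by positivity
      linarith [(h₁ f).2, (h₂ f).2]
  refine ⟨fun j => ?_, hweave⟩
  obtain ⟨C, D, hC, hCD, h⟩ := hweave
  -- A constant partition recovers each single family, so `V` is a fusion frame too.
  exact ⟨C, D, hC, hCD, h fun _ => j⟩
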